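/- Let $A$ and $B$ be rings with unit (not necessarily commutative) and let $f\colon A\to B$ be a finite ring epimorphism, i.e. an epimorphism in the category of rings with unit that turns $B$ into a finitely generated projective left $A$-module (via $a\cdot b=f(a)b$). Regard $f$ as a map $A\to B$ of left $A$-modules; it is then a map between finitely generated projective left $A$-modules. Let $f_{\{f\}}\colon A\to A_{\{f\}}$ denote the universal localisation of $A$ at $\{f\}$: a ring homomorphism such that $A_{\{f\}}\otimes_A f$ is an isomorphism, and such that every ring homomorphism $g\colon A\to C$ for which $C\otimes_A f$ is an isomorphism factors uniquely as $g=k\circ f_{\{f\}}$ with a ring homomorphism $k\colon A_{\{f\}}\to C$. Then $A_{\{f\}}$ exists, and $B$ lies in the same epiclass of $A$ as $A_{\{f\}}$: the maps $f$ and $f_{\{f\}}$ are both ring epimorphisms, and there is a ring isomorphism $h\colon B\to A_{\{f\}}$ with $f_{\{f\}}=h\circ f$. -/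

import Mathlib

open scoped TensorProduct

universe u

namespace RingEpi

noncomputable section

/-- A homomorphism of unital (not necessarily commutative) rings is a ring epimorphism if it is an
epimorphism in the category of rings with unit. -/
def IsRingEpi {A B : Type u} [Ring A] [Ring B] (f : A →+* B) : Prop :=
  CategoryTheory.Epi (RingCat.ofHom f)

/-- Two ring epimorphisms `f : A → B` and `g : A → C` are equivalent (that is, `B` and `C` lie in
the same epiclass of `A`) if there is a ring isomorphism `h : B → C` with `g = h ∘ f`. -/
def SameEpiclass {A B C : Type u} [Ring A] [Ring B] [Ring C] (f : A →+* B) (g : A →+* C) : Prop :=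
  IsRingEpi f ∧ IsRingEpi g ∧ ∃ h : B ≃+* C, g = (h : B →+* C).comp f

/-- A ring epimorphism `f : A → B` is finite if it turns `B` into a finitely generated projective
left `A`-module, where `A` acts by `a • b = f a * b`. -/
structure IsFiniteRingEpi {A B : Type u} [Ring A] [Ring B] (f : A →+* B) : Prop where
  epi : IsRingEpi f
  finite : letI := f.toModule; Module.Finite A B
  projective : letI := f.toModule; Module.Projective A B

/-- A map between finitely generated projective left `A`-modules, i.e. a morphism of `A-proj`. -/
structure ProjMap (A : Type u) [Ring A] where
  P : Type u
  Q : Type u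
  [addCommGroupP : AddCommGroup P]
  [addCommGroupQ : AddCommGroup Q]
  [moduleP : Module A P]
  [moduleQ : Module A Q]
  [finiteP : Module.Finite A P]
  [finiteQ : Module.Finite A Q]
  [projectiveP : Module.Projective A P]
  [projectiveQ : Module.Projective A Q]
  map : P →ₗ[A] Q

attribute [instance] ProjMap.addCommGroupP ProjMap.addCommGroupQ ProjMap.moduleP ProjMap.moduleQ
  ProjMap.finiteP ProjMap.finiteQ ProjMap.projectiveP ProjMap.projectiveQ

/-- A finite ring epimorphism `f : A → B`, regarded as a map of left `A`-modules between the
finitely generated projective modules `A` and `B`. -/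
def IsFiniteRingEpi.toProjMap {A B : Type u} [Ring A] [Ring B] {f : A →+* B}
    (hf : IsFiniteRingEpi f) : ProjMap A :=
  letI := f.toModule
  haveI := hf.finite
  haveI := hf.projective
  { P := A
    Q := B
    map :=
      { toFun := f
        map_add' := map_add f
        map_smul' := map_mul f } }

section Tensor

variable {A C : Type u} [Ring A] [Ring C]

/-- The relations `(c * g a) ⊗ p = c ⊗ (a • p)` imposed on `C ⊗_ℤ P` to obtain `C ⊗_A P`, where
`C` is a right `A`-module through the ring homomorphism `g : A → C`. They are stable under left
multiplication by `C`. -/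
def balancing (g : A →+* C) (P : Type u) [AddCommGroup P] [Module A P] :
    Submodule C (C ⊗[ℤ] P) :=
  Submodule.span C {x | ∃ (c : C) (a : A) (p : P), x = (c * g a) ⊗ₜ[ℤ] p - c ⊗ₜ[ℤ] (a • p)}

/-- The left `C`-module `C ⊗_A P`, for a ring homomorphism `g : A → C` and a left `A`-module
`P` (`A` is not assumed to be commutative). -/
abbrev ExtendScalars (g : A →+* C) (P : Type u) [AddCommGroup P] [Module A P] : Type u :=
  (C ⊗[ℤ] P) ⧸ balancing g P

/-- The map `C ⊗_A σ : C ⊗_A P → C ⊗_A Q`, `c ⊗ p ↦ c ⊗ σ p`. -/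
def extendScalarsMap (g : A →+* C) {P Q : Type u} [AddCommGroup P] [Module A P]
    [AddCommGroup Q] [Module A Q] (σ : P →ₗ[A] Q) :
    ExtendScalars g P →ₗ[C] ExtendScalars g Q :=
  Submodule.mapQ (balancing g P) (balancing g Q) ((σ.restrictScalars ℤ).baseChange C) (by
    refine Submodule.span_le.2 ?_
    rintro _ ⟨c, a, p, rfl⟩
    refine Submodule.subset_span ⟨c, a, σ p, ?_⟩
    simp)

/-- `g : A → C` inverts all maps in `S`: the map `C ⊗_A σ` is an isomorphism for all `σ ∈ S`. -/
def Inverts (g : A →+* C) (S : Set (ProjMap A)) : Prop :=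
  ∀ σ ∈ S, Function.Bijective (extendScalarsMap g σ.map)

end Tensor

/-- `l : A → L` is the universal localisation of `A` at the set `S` of maps between finitely
generated projective left `A`-modules: `l` inverts all maps in `S`, and every ring homomorphism
`g : A → C` inverting all maps in `S` factors in a unique way through `l`. -/
structure IsUniversalLocalisation {A L : Type u} [Ring A] [Ring L] (S : Set (ProjMap A))
    (l : A →+* L) : Prop where
  inverts : Inverts l S
  factors : ∀ (C : Type u) [Ring C] (g : A →+* C), Inverts g S →
    ∃! k : L →+* C, g = k.comp l

end

end RingEpi

namespace RingEpi

/-! The point is that `f` is its own universal localisation at `{f}`. Under `C ⊗_A A ≅ C`, the map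
`C ⊗_A f` becomes `c ↦ c ⊗ 1` from `C` to `C ⊗_A B`. For `C = B` it is bijective because `f` is an
epimorphism (`inverts_self`). If it is bijective for some `g : A → C`, then solving `k b ⊗ 1 = 1 ⊗
b` defines a ring homomorphism `k` extending `g` (`exists_factor`), unique since `f` is epi.
Universal localisations are unique up to isomorphism under `A`, so every model inherits the
conclusion from `f`. -/

theorem IsRingEpi.hom_ext {A B C : Type u} [Ring A] [Ring B] [Ring C] {f : A →+* B}
    (hf : IsRingEpi f) {g h : B →+* C} (H : g.comp f = h.comp f) : g = h := by
  have : CategoryTheory.Epi (RingCat.ofHom f) := hf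
  have key : RingCat.ofHom g = RingCat.ofHom h :=
    (CategoryTheory.cancel_epi (RingCat.ofHom f)).1 (by
      rw [← RingCat.ofHom_comp, ← RingCat.ofHom_comp, H])
  simpa using congrArg RingCat.Hom.hom key

theorem isRingEpi_of_hom_ext {A B : Type u} [Ring A] [Ring B] {f : A →+* B}
    (H : ∀ (C : Type u) [Ring C] (g h : B →+* C), g.comp f = h.comp f → g = h) :
    IsRingEpi f :=
  ⟨fun {Z} g h e => RingCat.hom_ext (H Z g.hom h.hom (by
    simpa using congrArg RingCat.Hom.hom e))⟩

/-- Along a ring epimorphism `A → B`, every `A`-linear map between `B`-modules is `B`-linear: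
the shear of `M × N` by the map commutes with `A`, hence with `B`. -/
theorem IsRingEpi.map_smul {A B M N : Type u} [Ring A] [Ring B] {f : A →+* B}
    (hf : IsRingEpi f) [AddCommGroup M] [Module B M] [AddCommGroup N] [Module B N]
    (φ : M →+ N) (hφ : ∀ (a : A) (m : M), φ (f a • m) = f a • φ m) (b : B) (m : M) :
    φ (b • m) = b • φ m := by
  let u : (AddMonoid.End (M × N))ˣ :=
    { val := AddMonoidHom.mk' (fun x => (x.1, x.2 + φ x.1))
        (fun x y => by ext <;> simp; abel)
      inv := AddMonoidHom.mk' (fun x => (x.1, x.2 - φ x.1))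
        (fun x y => by ext <;> simp; abel)
      val_inv := AddMonoidHom.ext fun x => Prod.ext rfl (sub_add_cancel x.2 (φ x.1))
      inv_val := AddMonoidHom.ext fun x => Prod.ext rfl (add_sub_cancel_right x.2 (φ x.1)) }
  let ρ : B →+* AddMonoid.End (M × N) := Module.toAddMonoidEnd B (M × N)
  -- The action `ρ` conjugated by the shear `u`; it agrees with `ρ` on the image of `f` exactly
  -- because `φ` is `A`-linear.
  let σ : B →+* AddMonoid.End (M × N) :=
    { toFun := fun b => u * ρ b * (u⁻¹ : (AddMonoid.End (M × N))ˣ)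
      map_one' := by simp
      map_mul' := fun b c => by simp [mul_assoc]
      map_zero' := by simp
      map_add' := fun b c => by simp [mul_add, add_mul] }
  have h : ρ = σ := hf.hom_ext (RingHom.ext fun a => (Units.eq_mul_inv_iff_mul_eq u).2
    (AddMonoidHom.ext fun x => Prod.ext rfl (by
      change f a • (x.2 + φ x.1) = f a • x.2 + φ (f a • x.1)
      rw [smul_add, hφ])))
  have h' : ρ b * u = u * ρ b :=
    (Units.eq_mul_inv_iff_mul_eq u).1 (DFunLike.congr_fun h b)
  have h'' : b • (0 + φ m) = b • (0 : N) + φ (b • m) :=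
    congrArg Prod.snd (DFunLike.congr_fun h' (m, 0))
  simpa using h''.symm

section Tensor

variable {A C : Type u} [Ring A] [Ring C] (g : A →+* C)
variable {P Q : Type u} [AddCommGroup P] [Module A P] [AddCommGroup Q] [Module A Q]

/-- The pure tensor `c ⊗ p` in `C ⊗_A P`. -/
def pureTensor (c : C) (p : P) : ExtendScalars g P :=
  Submodule.Quotient.mk (c ⊗ₜ[ℤ] p)

theorem pureTensor_add (c : C) (p q : P) :
    pureTensor g c (p + q) = pureTensor g c p + pureTensor g c q := by
  simp [pureTensor, TensorProduct.tmul_add]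

theorem add_pureTensor (c d : C) (p : P) :
    pureTensor g (c + d) p = pureTensor g c p + pureTensor g d p := by
  simp [pureTensor, TensorProduct.add_tmul]

theorem smul_pureTensor (c d : C) (p : P) :
    c • pureTensor g d p = pureTensor g (c * d) p := rfl

theorem pureTensor_smul (c : C) (a : A) (p : P) :
    pureTensor g c (a • p) = pureTensor g (c * g a) p :=
  ((Submodule.Quotient.eq _).2 (Submodule.subset_span
    (⟨c, a, p, rfl⟩ : ∃ (c' : C) (a' : A) (p' : P), (c * g a) ⊗ₜ[ℤ] p - c ⊗ₜ[ℤ] (a • p) =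
      (c' * g a') ⊗ₜ[ℤ] p' - c' ⊗ₜ[ℤ] (a' • p')))).symm

theorem extendScalarsMap_pureTensor (σ : P →ₗ[A] Q) (c : C) (p : P) :
    extendScalarsMap g σ (pureTensor g c p) = pureTensor g c (σ p) := rfl

theorem extendScalars_induction {p : ExtendScalars g P → Prop}
    (tmul : ∀ c x, p (pureTensor g c x)) (add : ∀ x y, p x → p y → p (x + y)) (x) : p x := by
  obtain ⟨x, rfl⟩ := Submodule.Quotient.mk_surjective _ x
  induction x using TensorProduct.induction_on with
  | zero => simpa [pureTensor] using tmul 0 0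
  | tmul c x => exact tmul c x
  | add x y hx hy => exact add _ _ hx hy

theorem exists_pureTensor_one (x : ExtendScalars g A) : ∃ c, x = pureTensor g c (1 : A) := by
  induction x using extendScalars_induction with
  | tmul c a => exact ⟨c * g a, by rw [← pureTensor_smul, smul_eq_mul, mul_one]⟩
  | add x y hx hy =>
    obtain ⟨c, rfl⟩ := hx
    obtain ⟨d, rfl⟩ := hy
    exact ⟨c + d, (add_pureTensor g c d 1).symm⟩

/-- The map `C ⊗_A P → C`, `c ⊗ p ↦ c * φ p`, induced by an `A`-linear map `φ : P → C`. -/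
def mulLift (φ : P →+ C) (hφ : ∀ (a : A) (p : P), φ (a • p) = g a * φ p) :
    ExtendScalars g P →ₗ[C] C :=
  Submodule.liftQ (balancing g P)
    { TensorProduct.lift ((LinearMap.mul ℤ C).compl₂ φ.toIntLinearMap) with
      map_smul' := fun c x => by
        induction x using TensorProduct.induction_on with
        | zero => simp
        | tmul d p => simp [TensorProduct.smul_tmul', mul_assoc]
        | add x y hx hy =>
          simp only [smul_add, AddHom.toFun_eq_coe, map_add] at hx hy ⊢
          rw [hx, hy] }
    (Submodule.span_le.2 (by
      rintro _ ⟨c, a, p, rfl⟩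
      simp [hφ, mul_assoc]))

theorem mulLift_pureTensor (φ : P →+ C) (hφ : ∀ (a : A) (p : P), φ (a • p) = g a * φ p)
    (c : C) (p : P) : mulLift g φ hφ (pureTensor g c p) = c * φ p := rfl

/-- The map `c ⊗ a ↦ c * g a` is a left inverse of `c ↦ c ⊗ 1`. -/
theorem pureTensor_one_injective {c d : C}
    (h : pureTensor g c (1 : A) = pureTensor g d (1 : A)) : c = d := by
  have : c * g 1 = d * g 1 :=
    congrArg (mulLift g g.toAddMonoidHom (fun a p => map_mul g a p)) h
  simpa using this

end Tensor

section Localisation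

variable {A B : Type u} [Ring A] [Ring B] {f : A →+* B} (hf : IsFiniteRingEpi f)

include hf

/-- Multiplication `B ⊗_A B → B` retracts `c ↦ c ⊗ 1`, giving injectivity. Surjectivity amounts to
`1 ⊗ b = b ⊗ 1`. -/
theorem IsFiniteRingEpi.inverts_self : Inverts f {hf.toProjMap} := by
  rintro _ rfl
  let _ := f.toModule
  let σ : A →ₗ[A] B := hf.toProjMap.map
  have hσ : ∀ c : B, extendScalarsMap f σ (pureTensor f c 1) = pureTensor f c (1 : B) := fun c =>
    (extendScalarsMap_pureTensor f σ c 1).trans (congrArg (pureTensor f c) (map_one f))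
  change Function.Bijective (extendScalarsMap f σ)
  constructor
  · intro x y hxy
    obtain ⟨c, rfl⟩ := exists_pureTensor_one f x
    obtain ⟨d, rfl⟩ := exists_pureTensor_one f y
    rw [hσ, hσ] at hxy
    have := congrArg (mulLift f (AddMonoidHom.id B) (fun _ _ => rfl)) hxy
    simp only [mulLift_pureTensor, AddMonoidHom.id_apply, mul_one] at this
    rw [this]
  · intro x
    induction x using extendScalars_induction with
    | tmul c b =>
      -- The map `x ↦ 1 ⊗ x` is `A`-linear between `B`-modules, hence `B`-linear; evaluating at `b •
      -- 1` yields `1 ⊗ b = b ⊗ 1`.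
      have key := hf.epi.map_smul
        (AddMonoidHom.mk' (fun x : B => pureTensor f 1 x) (pureTensor_add f 1))
        (fun a x => by
          have h := pureTensor_smul f 1 a x
          rw [one_mul] at h
          simp only [AddMonoidHom.mk'_apply, smul_pureTensor, mul_one]
          exact h) b 1
      simp only [AddMonoidHom.mk'_apply, smul_pureTensor, smul_eq_mul, mul_one] at key
      refine ⟨pureTensor f (c * b) 1, ?_⟩
      rw [hσ, ← smul_pureTensor, ← key, smul_pureTensor, mul_one]
    | add x y hx hy =>
      obtain ⟨x, rfl⟩ := hx
      obtain ⟨y, rfl⟩ := hy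
      exact ⟨x + y, map_add _ _ _⟩

theorem IsFiniteRingEpi.exists_factor {C : Type u} [Ring C] (g : A →+* C)
    (hg : Inverts g {hf.toProjMap}) : ∃ k : B →+* C, g = k.comp f := by
  let _ := f.toModule
  let σ : A →ₗ[A] B := hf.toProjMap.map
  have hσ : ∀ c : C, extendScalarsMap g σ (pureTensor g c 1) = pureTensor g c (1 : B) := fun c =>
    (extendScalarsMap_pureTensor g σ c 1).trans (congrArg (pureTensor g c) (map_one f))
  have hbij : Function.Bijective (extendScalarsMap g σ) := hg _ rfl
  have hinj : ∀ {c d : C}, pureTensor g c (1 : B) = pureTensor g d (1 : B) → c = d := fun h =>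
    pureTensor_one_injective g (hbij.1 (by rw [hσ, hσ, h]))
  have hex : ∀ b : B, ∃ c : C, pureTensor g c (1 : B) = pureTensor g 1 b := fun b => by
    obtain ⟨x, hx⟩ := hbij.2 (pureTensor g 1 b)
    obtain ⟨c, rfl⟩ := exists_pureTensor_one g x
    exact ⟨c, by rw [← hσ, hx]⟩
  choose k hk using hex
  have hadd : ∀ x y, k (x + y) = k x + k y := fun x y => hinj (by
    rw [hk, pureTensor_add, add_pureTensor, hk, hk])
  have hmul : ∀ x y, k (x * y) = k x * k y := fun x y => hinj (by
    -- Right multiplication by `y` is left `A`-linear, so `C ⊗_A r` carries `k x ⊗ 1 = 1 ⊗ x` to `k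
    -- x ⊗ y = 1 ⊗ (x * y)`; the left side is `(k x * k y) ⊗ 1`.
    let r : B →ₗ[A] B :=
      { toFun := fun z => z * y
        map_add' := fun z w => add_mul z w y
        map_smul' := fun a z => mul_assoc (f a) z y }
    have h1 : extendScalarsMap g r (pureTensor g (k x) 1) = pureTensor g (k x) y :=
      (extendScalarsMap_pureTensor g r _ _).trans (congrArg (pureTensor g (k x)) (one_mul y))
    rw [hk, ← smul_pureTensor, hk, smul_pureTensor, mul_one, ← h1, hk]
    rfl)
  refine ⟨RingHom.mk' ⟨⟨k, hinj (hk 1)⟩, hmul⟩ hadd, RingHom.ext fun a => hinj ?_⟩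
  change _ = pureTensor g (k (f a)) (1 : B)
  have h2 := pureTensor_smul g 1 a (1 : B)
  rw [one_mul] at h2
  rw [hk, ← h2]
  exact congrArg (pureTensor g 1) (mul_one (f a))

/-- A finite ring epimorphism is its own universal localisation. -/
theorem IsFiniteRingEpi.isUniversalLocalisation :
    IsUniversalLocalisation {hf.toProjMap} f where
  inverts := hf.inverts_self
  factors C _ g hg := by
    obtain ⟨k, hk⟩ := hf.exists_factor g hg
    exact ⟨k, hk, fun k' hk' => hf.epi.hom_ext (hk'.symm.trans hk)⟩

end Localisation

/-- Two universal localisations at the same set of maps are isomorphic under `A`. -/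
theorem IsUniversalLocalisation.exists_ringEquiv {A L M : Type u} [Ring A] [Ring L] [Ring M]
    {S : Set (ProjMap A)} {l : A →+* L} {m : A →+* M} (hl : IsUniversalLocalisation S l)
    (hm : IsUniversalLocalisation S m) : ∃ h : L ≃+* M, m = (h : L →+* M).comp l := by
  obtain ⟨k, hk, -⟩ := hl.factors M m hm.inverts
  obtain ⟨j, hj, -⟩ := hm.factors L l hl.inverts
  refine ⟨RingEquiv.ofRingHom k j ?_ ?_, hk⟩
  · refine (hm.factors M m hm.inverts).unique ?_ (RingHom.id_comp m).symm
    rw [RingHom.comp_assoc, ← hj, ← hk]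
  · refine (hl.factors L l hl.inverts).unique ?_ (RingHom.id_comp l).symm
    rw [RingHom.comp_assoc, ← hk, ← hj]

end RingEpi

/-- For a finite ring epimorphism `f : A → B`, the universal localisation of `A` at `{f}` exists,
and (any model of) it lies in the same epiclass of `A` as `B`. -/
theorem corollary3p4 {A B : Type u} [Ring A] [Ring B] (f : A →+* B)
    (hf : RingEpi.IsFiniteRingEpi f) :
    (∃ (L : Type u) (_ : Ring L) (l : A →+* L),
      RingEpi.IsUniversalLocalisation {hf.toProjMap} l) ∧
    ∀ (L : Type u) [Ring L] (l : A →+* L),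
      RingEpi.IsUniversalLocalisation {hf.toProjMap} l → RingEpi.SameEpiclass f l := by
  refine ⟨⟨B, inferInstance, f, hf.isUniversalLocalisation⟩, fun L _ l hl => ?_⟩
  obtain ⟨h, rfl⟩ := hf.isUniversalLocalisation.exists_ringEquiv hl
  refine ⟨hf.epi, RingEpi.isRingEpi_of_hom_ext fun C _ g g' e => ?_, h, rfl⟩
  -- The localisation map is `h ∘ f` with `h` invertible: cancel the epimorphism `f`, then `h`.
  have key : g.comp (h : B →+* L) = g'.comp (h : B →+* L) :=
    hf.epi.hom_ext (by simpa only [RingHom.comp_assoc] using e)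
  ext x
  simpa using DFunLike.congr_fun key (h.symm x)
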